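/- **Setting.** Let $1\le n$, $1\le k<d$ and $m$ be integers. Let $\mathbf Z=\mathrm{diag}(1,\dots,d)$ and let $\Omega_{\rm DIF}:\mathbb R^d\to\mathbb R^{d-1}$, $(\Omega_{\rm DIF}x)_i=x_i-x_{i+1}$. Coefficient vectors $b=(b_0,\dots,b_n)$, $b_j\in\mathbb R^d$, parameterize the signal $f=\sum_{j=0}^n \mathbf Z^j b_j\in\mathbb R^d$; their jump set is $T(b)=\mathrm{supp}\sum_{j}|\Omega_{\rm DIF}b_j|\subseteq\{1,\dots,d-1\}$. A signal is a *piecewise polynomial function of order $n$ with $k$ jumps* if it has a parameterization $b$ with $|T(b)|\le k$. A matrix $\mathbf M\in\mathbb R^{m\times d}$ has the $P_n$-RIP with constant $\delta_k$ if $(1-\delta_k)\|f\|_2^2\le\|\mathbf Mf\|_2^2\le(1+\delta_k)\|f\|_2^2$ for all such $f$. For $v\in\mathbb R^d$ let $S_n(v,k)$ denote a parameterization with at most $k$ jumps of a signal closest to $v$ in $\ell_2$ among the piecewise polynomial functions of order $n$ with $k$ jumps. **SSCoSaMP** with input $k$, $\mathbf M$, $\mathbf g$ and $\gamma=2$: start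 with $T^0=\emptyset$, $f^0=0$, $\mathbf g_r^0=\mathbf g$; in iteration $t\ge1$ let $T_\Delta$ be the jump set of $S_n(\mathbf M^T\mathbf g_r^{t-1},2k)$, let $\tilde T=T^{t-1}\cup T_\Delta$, let $b_p$ minimize $\|\mathbf g-\mathbf M\sum_j\mathbf Z^j\tilde b_j\|_2^2$ over all $\tilde b$ with $T(\tilde b)\subseteq\tilde T$, let $f^t$ and $T^t$ be the signal and the jump set of the parameterization $S_n(\sum_j\mathbf Z^j b_{p,j},k)$, and let $\mathbf g_r^t=\mathbf g-\mathbf Mf^t$. Ties among minimizers may be broken in any way. **Theorem.** There is a function $C_0:\mathbb R\to(2,\infty)$ such that the following holds in this setting, for all $n,k,m,d$ as above. Let $f$ be a piecewise polynomial function of order $n$ with $k$ jumps, let $\mathbf M$ satisfy the $P_n$-RIP with constants $\delta_{3k}$ (for $3k$ jumps) and $\delta_{4k}<0.046$ (for $4k$ jumps), let $\sigma\ge0$, $\beta\ge0$, and let $\mathbf g=\mathbf Mf+\mathbf e$, where $\mathbf e\in\mathbb R^m$ is zero-mean white Gaussian noise with variance $\sigma^2$. Then there are a number of iterations $t_0$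 that does not depend on the realization of the noise, and an event of probability exceeding $$1-\frac{2}{(3k)!}(nd)^{-\beta},$$ on which, for every run of SSCoSaMP and every number $t\ge t_0$ of iterations, the estimate $\hat f=f^t$ satisfies $$\|\hat f-f\|_2\le C\sqrt{(1+\delta_{3k})\,3k}\,\Bigl(1+\sqrt{2(1+\beta)\log(nd)}\Bigr)\sigma,\qquad C=C_0(\delta_{4k})\sqrt{n+1}.$$ Thus the constant $C$ depends only on $\delta_{4k}$ and the order $n$. -/

import Mathlib

open MeasureTheory ProbabilityTheory

noncomputable section

/-- Coefficient vectors `b₀, …, bₙ ∈ ℝᵈ` of the parameterization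
`f = [I, Z, Z², …, Zⁿ] [b₀ᵀ, …, bₙᵀ]ᵀ`, where `Z = diag(1, …, d)`. -/
abbrev Coeffs (n d : ℕ) : Type := Fin (n + 1) → Fin d → ℝ

/-- The finite-difference operator `Ω_DIF : ℝᵈ → ℝᵈ⁻¹`, which applies the filter `[1, -1]`. -/
def omegaDif {d : ℕ} (x : Fin d → ℝ) : Fin (d - 1) → ℝ := fun i =>
  x ⟨i.val, by omega⟩ - x ⟨i.val + 1, by omega⟩

/-- The signal `[I, Z, …, Zⁿ] [b₀ᵀ, …, bₙᵀ]ᵀ`: its `i`-th entry, `i = 1, …, d`, is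
`∑ⱼ iʲ bⱼ(i)` (the indices of `Fin d` start at `0`, whence the shift). -/
def synth {n d : ℕ} (b : Coeffs n d) : EuclideanSpace ℝ (Fin d) :=
  WithLp.toLp 2 fun i => ∑ j : Fin (n + 1), ((i.val : ℝ) + 1) ^ j.val * b j i

open Classical in
/-- The jump locations of a parameterization: the support of `∑ⱼ |Ω_DIF bⱼ|`. -/
def jumps {n d : ℕ} (b : Coeffs n d) : Finset (Fin (d - 1)) :=
  Finset.univ.filter fun i => ∑ j : Fin (n + 1), |omegaDif (b j) i| ≠ 0

/-- `f` is a piecewise polynomial function of order `n` with (at most) `k` jumps. -/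
def IsPiecewisePoly {d : ℕ} (n k : ℕ) (f : EuclideanSpace ℝ (Fin d)) : Prop :=
  ∃ b : Coeffs n d, (jumps b).card ≤ k ∧ synth b = f

/-- `M` has the polynomial restricted isometry property of order `n` (`Pₙ`-RIP) with constant `δ`
for signals with `k` jumps. -/
def HasPolyRIP {m d : ℕ} (n k : ℕ) (M : Matrix (Fin m) (Fin d) ℝ) (δ : ℝ) : Prop :=
  ∀ f : EuclideanSpace ℝ (Fin d), IsPiecewisePoly n k f →
    (1 - δ) * ‖f‖ ^ 2 ≤ ‖M.toEuclideanLin f‖ ^ 2 ∧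
      ‖M.toEuclideanLin f‖ ^ 2 ≤ (1 + δ) * ‖f‖ ^ 2

/-- `b` is an admissible output of the projection `Sₙ(v, k)`: a parameterization with at most `k`
jumps of a signal which is closest to `v` among all piecewise polynomial functions of order `n`
with at most `k` jumps. -/
def IsProjection {n d : ℕ} (v : EuclideanSpace ℝ (Fin d)) (k : ℕ) (b : Coeffs n d) : Prop :=
  (jumps b).card ≤ k ∧
    ∀ h : EuclideanSpace ℝ (Fin d), IsPiecewisePoly n k h → ‖v - synth b‖ ≤ ‖v - h‖

/-- The coefficients `b` satisfy `(Ω_DIF bⱼ)_{Tᶜ} = 0` for all `j`. -/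
def JumpsWithin {n d : ℕ} (T : Finset (Fin (d - 1))) (b : Coeffs n d) : Prop :=
  ∀ i, i ∉ T → ∀ j, omegaDif (b j) i = 0

/-- `b` minimizes `‖g - M [I, Z, …, Zⁿ] b‖₂²` under the constraint `(Ω_DIF bⱼ)_{Tᶜ} = 0` for all
`j`. -/
def IsConstrainedLS {n m d : ℕ} (M : Matrix (Fin m) (Fin d) ℝ) (g : EuclideanSpace ℝ (Fin m))
    (T : Finset (Fin (d - 1))) (b : Coeffs n d) : Prop :=
  JumpsWithin T b ∧ ∀ b' : Coeffs n d, JumpsWithin T b' →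
    ‖g - M.toEuclideanLin (synth b)‖ ^ 2 ≤ ‖g - M.toEuclideanLin (synth b')‖ ^ 2

/-- The state of SSCoSaMP after an iteration: the jump locations `Tᵗ`, the estimate `fᵗ` and the
residual `g_rᵗ`. -/
structure SSCoSaMPState (m d : ℕ) where
  /-- the jump locations -/
  jumpSet : Finset (Fin (d - 1))
  /-- the estimate -/
  estimate : EuclideanSpace ℝ (Fin d)
  /-- the residual -/
  residual : EuclideanSpace ℝ (Fin m)

/-- One iteration of SSCoSaMP from the state `s` to the state `s'`, for every way of choosing
among several minimizers:
* `br` is the parameterization of `Sₙ(Mᵀ g_r, γ k)`, its jumps are joined to the current ones;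
* `bp` is the least-squares solution with jumps in the joint set;
* `b` is the parameterization of the new estimate `Sₙ([I, Z, …, Zⁿ] bp, k)`. -/
def SSCoSaMPStep {m d : ℕ} (n k γ : ℕ) (M : Matrix (Fin m) (Fin d) ℝ)
    (g : EuclideanSpace ℝ (Fin m)) (s s' : SSCoSaMPState m d) : Prop :=
  ∃ br bp b : Coeffs n d,
    IsProjection (M.transpose.toEuclideanLin s.residual) (γ * k) br ∧
    IsConstrainedLS M g (s.jumpSet ∪ jumps br) bp ∧
    IsProjection (synth bp) k b ∧
    s'.estimate = synth b ∧
    s'.jumpSet = jumps b ∧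
    s'.residual = g - M.toEuclideanLin s'.estimate

/-- `s 0, s 1, s 2, …` is a run of SSCoSaMP with input `k, M, g, γ` for piecewise polynomial
functions of order `n`; `(s t).estimate` is the estimate after `t` iterations. -/
structure IsSSCoSaMPRun {m d : ℕ} (n k γ : ℕ) (M : Matrix (Fin m) (Fin d) ℝ)
    (g : EuclideanSpace ℝ (Fin m)) (s : ℕ → SSCoSaMPState m d) : Prop where
  init : s 0 = ⟨∅, 0, g⟩
  step : ∀ t, SSCoSaMPStep n k γ M g (s t) (s (t + 1))

/-- `e` is zero-mean white Gaussian noise with variance `σ²`: its entries are independent with law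
`N(0, σ²)`. -/
def IsWhiteGaussianNoise {Ω : Type*} [MeasurableSpace Ω] {m : ℕ} (P : Measure Ω)
    (e : Ω → EuclideanSpace ℝ (Fin m)) (σ : ℝ) : Prop :=
  iIndepFun (fun i ω => e ω i) P ∧
    ∀ i, HasLaw (fun ω => e ω i) (gaussianReal 0 (Real.toNNReal (σ ^ 2))) P

/-! Sanity check: SSCoSaMP can always be run. -/

/-- Least squares over the image of a subspace has a solution. -/
theorem exists_min_norm_sub {V : Type*} [AddCommGroup V] [Module ℝ V] {F : Type*}
    [NormedAddCommGroup F] [NormedSpace ℝ F] [FiniteDimensional ℝ F] (L : V →ₗ[ℝ] F)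
    (W : Submodule ℝ V) (y : F) : ∃ w ∈ W, ∀ w' ∈ W, ‖y - L w‖ ≤ ‖y - L w'‖ := by
  have : ProperSpace F := FiniteDimensional.proper ℝ F
  obtain ⟨z, hz, hy⟩ := (Submodule.closed_of_finiteDimensional (W.map L)).exists_infDist_eq_dist
    ⟨0, (W.map L).zero_mem⟩ y
  obtain ⟨w, hw, rfl⟩ := hz
  refine ⟨w, hw, fun w' hw' => ?_⟩
  rw [← dist_eq_norm, ← dist_eq_norm, ← hy]
  exact Metric.infDist_le_dist_of_mem ⟨w', hw', rfl⟩

/-- `synth` as a linear map. -/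
def synthLin (n d : ℕ) : Coeffs n d →ₗ[ℝ] EuclideanSpace ℝ (Fin d) where
  toFun := synth
  map_add' a b := by
    ext i
    simp [synth, mul_add, Finset.sum_add_distrib]
  map_smul' c b := by
    ext i
    simp only [synth, Pi.smul_apply, smul_eq_mul, RingHom.id_apply, PiLp.smul_apply,
      Finset.mul_sum]
    exact Finset.sum_congr rfl fun j _ => by ring

/-- The subspace of all coefficients with jumps in `T`. -/
def withinSubmodule (n : ℕ) {d : ℕ} (T : Finset (Fin (d - 1))) : Submodule ℝ (Coeffs n d) where
  carrier := {b | JumpsWithin T b}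
  zero_mem' := fun i _ j => by simp [omegaDif]
  add_mem' := fun {a b} ha hb i hi j => by
    have h1 := ha i hi j
    have h2 := hb i hi j
    simp only [omegaDif, Pi.add_apply] at h1 h2 ⊢
    linarith
  smul_mem' := fun c b hb i hi j => by
    have h1 := hb i hi j
    simp only [omegaDif, Pi.smul_apply, smul_eq_mul] at h1 ⊢
    rw [← mul_sub, h1, mul_zero]

theorem jumpsWithin_iff {n d : ℕ} (T : Finset (Fin (d - 1))) (b : Coeffs n d) :
    JumpsWithin T b ↔ jumps b ⊆ T := by
  have key : ∀ i, i ∈ jumps b ↔ ∃ j, omegaDif (b j) i ≠ 0 := by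
    intro i
    rw [jumps, Finset.mem_filter, Ne,
      Finset.sum_eq_zero_iff_of_nonneg fun j _ => abs_nonneg (omegaDif (b j) i)]
    simp
  constructor
  · intro h i hi
    obtain ⟨j, hj⟩ := (key i).1 hi
    by_contra hT
    exact hj (h i hT j)
  · intro h i hi j
    by_contra hj
    exact hi (h ((key i).2 ⟨j, hj⟩))

theorem exists_isProjection (n : ℕ) {d : ℕ} (v : EuclideanSpace ℝ (Fin d)) (k : ℕ) :
    ∃ b : Coeffs n d, IsProjection v k b := by
  choose w hw hmin using fun T : Finset (Fin (d - 1)) =>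
    exists_min_norm_sub (synthLin n d) (withinSubmodule n T) v
  obtain ⟨T, hT, hTmin⟩ := Finset.exists_min_image
    (Finset.univ.filter fun T : Finset (Fin (d - 1)) => T.card ≤ k)
    (fun T => ‖v - synthLin n d (w T)‖) ⟨∅, by simp⟩
  refine ⟨w T, (Finset.card_le_card ((jumpsWithin_iff T _).1 (hw T))).trans (by simpa using hT),
    ?_⟩
  rintro h ⟨b, hb, rfl⟩
  exact (hTmin (jumps b) (by simpa using hb)).trans
    (hmin (jumps b) b ((jumpsWithin_iff _ b).2 subset_rfl))

theorem exists_isConstrainedLS (n : ℕ) {m d : ℕ} (M : Matrix (Fin m) (Fin d) ℝ)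
    (g : EuclideanSpace ℝ (Fin m)) (T : Finset (Fin (d - 1))) :
    ∃ b : Coeffs n d, IsConstrainedLS M g T b := by
  obtain ⟨b, hb, hmin⟩ := exists_min_norm_sub (M.toEuclideanLin ∘ₗ synthLin n d)
    (withinSubmodule n T) g
  exact ⟨b, hb, fun b' hb' => pow_le_pow_left₀ (norm_nonneg _) (hmin b' hb') 2⟩

/-- Every input admits a run of SSCoSaMP. -/
theorem exists_isSSCoSaMPRun {m d : ℕ} (n k γ : ℕ) (M : Matrix (Fin m) (Fin d) ℝ)
    (g : EuclideanSpace ℝ (Fin m)) : ∃ s, IsSSCoSaMPRun n k γ M g s := by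
  have hstep : ∀ s : SSCoSaMPState m d, ∃ s', SSCoSaMPStep n k γ M g s s' := by
    intro s
    obtain ⟨br, hbr⟩ := exists_isProjection n (M.transpose.toEuclideanLin s.residual) (γ * k)
    obtain ⟨bp, hbp⟩ := exists_isConstrainedLS n M g (s.jumpSet ∪ jumps br)
    obtain ⟨b, hb⟩ := exists_isProjection n (synth bp) k
    exact ⟨⟨jumps b, synth b, g - M.toEuclideanLin (synth b)⟩, br, bp, b, hbr, hbp, hb,
      rfl, rfl, rfl⟩
  choose nxt hnxt using hstep
  exact ⟨fun t => Nat.rec ⟨∅, 0, g⟩ (fun _ s => nxt s) t, rfl, fun t => hnxt _⟩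

end

/-!
The signals whose jumps lie in a fixed set `T` form a linear space `signalSpace n T` of dimension at
most `(n + 1) (|T| + 1)`, and a sum of two signals has its jumps in the union of the two jump sets.
All differences that occur in an iteration of SSCoSaMP have at most `4 k` jumps, so that the
restricted isometry property makes `M` almost preserve their inner products
(`HasPolyRIP.inner_sub_inner_le`).

Let `ν` bound the correlation of the noise `e` with `M z` for unit signals `z` with at most `4 k`
jumps (`NoiseBound`). If `x` is the current error, then the optimality of the projection `u` of
`Mᵀ (M x + e)` against the competitor `x` gives `‖x - u‖ ≤ 2 (δ ‖x‖ + ν)`. So the enlarged jump set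
admits a signal close to the true one, the least-squares estimate is almost as good as that signal,
and the final projection loses at most a factor `2`. For `δ < 0.046` this makes the error shrink
by the factor `2 / 5` up to `11 ν` (`SSCoSaMPStep.norm_estimate_sub_le`), hence
`‖fᵗ - f‖ ≤ (2 / 5) ^ t ‖f‖ + 19 ν`.

The noise enters through a chi-square tail bound for every fixed jump set. In an orthonormal basis
`uᵢ` of `signalSpace n T` it suffices to bound `∑ᵢ ⟪M uᵢ, e⟫²`, whose exponential moment is computed
by introducing an auxiliary Gaussian vector and exchanging the integrals
(`IsWhiteGaussianNoise.lintegral_exp_sum_inner_sq_le`). A union bound over at most `d ^ (4 k)` sets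
yields `ν` of the order of `σ √((n + 1) k) (1 + √((1 + β) log (n d)))`. The condition for `4 k`
jumps controls the noise as well, since `1 + δ₄ ≤ 2 ≤ 2 (1 + δ₃)`.

If `σ > 0`, then `(2 / 5) ^ t ‖f‖` is eventually below `σ`. If `σ = 0`, the asserted bound is `0`. As
there are only finitely many jump sets, an estimate close enough to `f` has a jump set that
admits `f`, and from then on the iteration returns `f` exactly (`exists_forall_estimate_eq`).
-/

open scoped RealInnerProductSpace

/-! ### Subspaces of signals with prescribed jump locations -/

/-- The subspace of all signals that have a parameterization with jumps in `T`. -/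
noncomputable def signalSpace (n : ℕ) {d : ℕ} (T : Finset (Fin (d - 1))) :
    Submodule ℝ (EuclideanSpace ℝ (Fin d)) :=
  (withinSubmodule n T).map (synthLin n d)

section SignalSpace

variable {n d ℓ : ℕ} {S T : Finset (Fin (d - 1))}

theorem synth_mem_signalSpace {b : Coeffs n d} (hb : jumps b ⊆ T) :
    synth b ∈ signalSpace n T :=
  ⟨b, (jumpsWithin_iff T b).2 hb, rfl⟩

theorem exists_of_mem_signalSpace {x : EuclideanSpace ℝ (Fin d)} (hx : x ∈ signalSpace n T) :
    ∃ b : Coeffs n d, jumps b ⊆ T ∧ synth b = x := by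
  obtain ⟨b, hb, rfl⟩ := hx
  exact ⟨b, (jumpsWithin_iff T b).1 hb, rfl⟩

theorem signalSpace_mono (h : S ⊆ T) : signalSpace n S ≤ signalSpace n T := by
  intro x hx
  obtain ⟨b, hb, rfl⟩ := exists_of_mem_signalSpace hx
  exact synth_mem_signalSpace (hb.trans h)

theorem isPiecewisePoly_iff {x : EuclideanSpace ℝ (Fin d)} :
    IsPiecewisePoly n ℓ x ↔ ∃ T : Finset (Fin (d - 1)), T.card ≤ ℓ ∧ x ∈ signalSpace n T := by
  constructor
  · rintro ⟨b, hb, rfl⟩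
    exact ⟨jumps b, hb, synth_mem_signalSpace subset_rfl⟩
  · rintro ⟨T, hT, hx⟩
    obtain ⟨b, hb, rfl⟩ := exists_of_mem_signalSpace hx
    exact ⟨b, (Finset.card_le_card hb).trans hT, rfl⟩

/-- Each of the `n + 1` coefficient vectors is determined by its first entry and its differences
at the locations in `T`. -/
theorem finrank_signalSpace_le (n : ℕ) (hd : 0 < d) (T : Finset (Fin (d - 1))) :
    Module.finrank ℝ (signalSpace n T) ≤ (n + 1) * (T.card + 1) := by
  refine (Submodule.finrank_map_le _ _).trans ?_
  let φ : Coeffs n d →ₗ[ℝ] (Fin (n + 1) → Option T → ℝ) :=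
    { toFun := fun b j o => o.elim (b j ⟨0, hd⟩) fun i => omegaDif (b j) i
      map_add' := fun a b => by
        ext j o
        cases o <;> simp [omegaDif]
        ring
      map_smul' := fun c b => by
        ext j o
        cases o <;> simp [omegaDif]
        ring }
  have hinj : Function.Injective (φ ∘ₗ (withinSubmodule n T).subtype) := by
    rw [← LinearMap.ker_eq_bot, LinearMap.ker_eq_bot']
    rintro ⟨b, hb⟩ h0
    have h0' : ∀ j o, φ b j o = 0 := fun j o => congrFun (congrFun h0 j) o
    have key : ∀ (j : Fin (n + 1)) (i : ℕ) (hi : i < d), b j ⟨i, hi⟩ = 0 := by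
      intro j i
      induction i with
      | zero => exact fun _ => h0' j none
      | succ i ih =>
        intro hi
        have h1 := ih (by omega)
        have h2 : omegaDif (b j) ⟨i, by omega⟩ = 0 := by
          by_cases hT : (⟨i, by omega⟩ : Fin (d - 1)) ∈ T
          · exact h0' j (some ⟨_, hT⟩)
          · exact hb _ hT j
        simp only [omegaDif, h1] at h2
        linarith
    exact Subtype.ext (funext fun j => funext fun i => key j i i.2)
  have := LinearMap.finrank_le_finrank_of_injective hinj
  rw [Module.finrank_pi_fintype] at this
  simpa using this

end SignalSpace

/-! ### Consequences of the restricted isometry property -/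

section Deterministic

variable {n m d k ℓ : ℕ} {M : Matrix (Fin m) (Fin d) ℝ} {δ ν : ℝ}
  {e : EuclideanSpace ℝ (Fin m)} {S T : Finset (Fin (d - 1))}

theorem inner_transpose_toEuclideanLin (M : Matrix (Fin m) (Fin d) ℝ)
    (y : EuclideanSpace ℝ (Fin m)) (x : EuclideanSpace ℝ (Fin d)) :
    ⟪M.transpose.toEuclideanLin y, x⟫ = ⟪y, M.toEuclideanLin x⟫ := by
  rw [← M.conjTranspose_eq_transpose_of_trivial, Matrix.toEuclideanLin_conjTranspose_eq_adjoint,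
    LinearMap.adjoint_inner_left]

/-- Constant signals are piecewise polynomial, so that the two bounds of the restricted isometry
property apply to some nonzero signal. -/
theorem HasPolyRIP.nonneg (hM : HasPolyRIP n ℓ M δ) (hd : 0 < d) : 0 ≤ δ := by
  obtain ⟨x, hx, hx0⟩ : ∃ x : EuclideanSpace ℝ (Fin d), IsPiecewisePoly n ℓ x ∧ x ≠ 0 := by
    refine ⟨synth fun j _ => if j = 0 then 1 else 0, ⟨_, ?_, rfl⟩, fun h => ?_⟩
    · simp [jumps, omegaDif]
    · simpa [synth] using congrArg (fun v => v.ofLp ⟨0, hd⟩) h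
  have h := hM x hx
  have : 0 < ‖x‖ ^ 2 := by positivity
  nlinarith [h.1.trans h.2]

/-- On signals with jointly at most `ℓ` jumps, `M` almost preserves inner products. -/
theorem HasPolyRIP.inner_sub_inner_le (hM : HasPolyRIP n ℓ M δ) (hT : T.card ≤ ℓ)
    {x y : EuclideanSpace ℝ (Fin d)} (hx : x ∈ signalSpace n T) (hy : y ∈ signalSpace n T) :
    ⟪M.toEuclideanLin x, M.toEuclideanLin y⟫ - ⟪x, y⟫ ≤ δ * (‖x‖ * ‖y‖) := by
  have key : ∀ x ∈ signalSpace n T, ∀ y ∈ signalSpace n T,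
      2 * (⟪M.toEuclideanLin x, M.toEuclideanLin y⟫ - ⟪x, y⟫) ≤
        δ * (‖x‖ ^ 2 + ‖y‖ ^ 2) := by
    intro x hx y hy
    have h1 := (hM (x + y) (isPiecewisePoly_iff.2 ⟨T, hT, add_mem hx hy⟩)).2
    have h2 := (hM (x - y) (isPiecewisePoly_iff.2 ⟨T, hT, sub_mem hx hy⟩)).1
    rw [map_add, norm_add_sq_real, norm_add_sq_real] at h1
    rw [map_sub, norm_sub_sq_real, norm_sub_sq_real] at h2
    linarith
  rcases eq_or_ne x 0 with rfl | hx0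
  · simp
  rcases eq_or_ne y 0 with rfl | hy0
  · simp
  -- The rescaled vectors have equal norms, which turns the sum of squares into a product.
  have h := key (‖y‖ • x) (Submodule.smul_mem _ _ hx) (‖x‖ • y) (Submodule.smul_mem _ _ hy)
  simp only [map_smul, real_inner_smul_left, real_inner_smul_right, norm_smul, norm_norm] at h
  have hpos : 0 < ‖x‖ * ‖y‖ := by positivity
  refine le_of_mul_le_mul_left ?_ hpos
  linarith

theorem HasPolyRIP.inner_sub_inner_le' (hM : HasPolyRIP n ℓ M δ) (hT : T.card ≤ ℓ)
    {x y : EuclideanSpace ℝ (Fin d)} (hx : x ∈ signalSpace n T) (hy : y ∈ signalSpace n T) :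
    ⟪x, y⟫ - ⟪M.toEuclideanLin x, M.toEuclideanLin y⟫ ≤ δ * (‖x‖ * ‖y‖) := by
  have h := hM.inner_sub_inner_le hT hx (neg_mem hy)
  simp only [map_neg, inner_neg_right, norm_neg] at h
  linarith

/-! ### One iteration of SSCoSaMP -/

/-- The noise `e` correlates with the image `M z` of a signal `z` with at most `ℓ` jumps by at most
`ν ‖z‖`. Equivalently, for `ν ≥ 0`, every orthogonal projection of `Mᵀ e` to a space of signals with at most
`ℓ` fixed jump locations has norm at most `ν`. -/
def NoiseBound (n ℓ : ℕ) {m d : ℕ} (M : Matrix (Fin m) (Fin d) ℝ)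
    (e : EuclideanSpace ℝ (Fin m)) (ν : ℝ) : Prop :=
  ∀ T : Finset (Fin (d - 1)), T.card ≤ ℓ → ∀ z ∈ signalSpace n T,
    ⟪e, M.toEuclideanLin z⟫ ≤ ν * ‖z‖

/-- The projection of the proxy `Mᵀ (M x + e)` approximates `x`. -/
theorem norm_sub_synth_le_of_isProjection (hM : HasPolyRIP n ℓ M δ) (hδ : 0 ≤ δ) (hν : 0 ≤ ν)
    (he : NoiseBound n ℓ M e ν)
    {x : EuclideanSpace ℝ (Fin d)} (hx : x ∈ signalSpace n S) (hS : S.card ≤ k)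
    {b : Coeffs n d} (hb : IsProjection (M.transpose.toEuclideanLin (M.toEuclideanLin x + e)) k b)
    (hcard : (S ∪ jumps b).card ≤ ℓ) :
    ‖x - synth b‖ ≤ 2 * (δ * ‖x‖ + ν) := by
  set u := synth b
  set h := M.transpose.toEuclideanLin (M.toEuclideanLin x + e) with hh
  have hxW : x ∈ signalSpace n (S ∪ jumps b) := signalSpace_mono Finset.subset_union_left hx
  have huW : u ∈ signalSpace n (S ∪ jumps b) :=
    synth_mem_signalSpace Finset.subset_union_right
  have hz : u - x ∈ signalSpace n (S ∪ jumps b) := sub_mem huW hxW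
  have hopt : ‖h - u‖ ^ 2 ≤ ‖h - x‖ ^ 2 :=
    pow_le_pow_left₀ (norm_nonneg _) (hb.2 x (isPiecewisePoly_iff.2 ⟨S, hS, hx⟩)) 2
  have h1 : h - u = (h - x) - (u - x) := by abel
  rw [h1, norm_sub_sq_real, inner_sub_left, hh, inner_transpose_toEuclideanLin,
    inner_add_left] at hopt
  have h2 := hM.inner_sub_inner_le hcard hxW hz
  have h3 := he _ hcard _ hz
  rw [norm_sub_rev x u]
  rcases (norm_nonneg (u - x)).eq_or_lt with h0 | h0
  · rw [← h0]
    positivity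
  · refine le_of_mul_le_mul_right ?_ h0
    nlinarith

theorem IsConstrainedLS.inner_eq_zero {g : EuclideanSpace ℝ (Fin m)} {b : Coeffs n d}
    (hb : IsConstrainedLS M g T b) {z : EuclideanSpace ℝ (Fin d)} (hz : z ∈ signalSpace n T) :
    ⟪g - M.toEuclideanLin (synth b), M.toEuclideanLin z⟫ = 0 := by
  set r := g - M.toEuclideanLin (synth b) with hr
  set c := ⟪r, M.toEuclideanLin z⟫
  obtain ⟨a, ha, rfl⟩ := hz
  have key : ∀ s : ℝ, 0 ≤ -2 * s * c + s ^ 2 * ‖M.toEuclideanLin (synthLin n d a)‖ ^ 2 := by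
    intro s
    have h := hb.2 (b + s • a)
      ((withinSubmodule n T).add_mem hb.1 ((withinSubmodule n T).smul_mem s ha))
    have h1 : synth (b + s • a) = synth b + s • synthLin n d a := by
      change synthLin n d (b + s • a) = synthLin n d b + _
      rw [map_add, map_smul]
    rw [h1, map_add, map_smul, ← sub_sub, ← hr, norm_sub_sq_real r, real_inner_smul_right, norm_smul,
      mul_pow, Real.norm_eq_abs, sq_abs] at h
    linarith
  set q := ‖M.toEuclideanLin (synthLin n d a)‖ ^ 2
  have hq : 0 ≤ q := by positivity
  -- The quadratic polynomial is negative at a point near its minimizer, unless `c = 0`.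
  have h := key (c / (q + 1))
  have h2 : -2 * (c / (q + 1)) * c + (c / (q + 1)) ^ 2 * q = -(c ^ 2 * (q + 2)) / (q + 1) ^ 2 := by
    field_simp
    ring
  rw [h2, le_div_iff₀ (by positivity), zero_mul] at h
  have : c ^ 2 = 0 := by nlinarith [sq_nonneg c]
  simpa using this

/-- The least-squares estimate is almost as good as every signal `y` with the same admissible jump
locations. -/
theorem norm_sub_synth_le_of_isConstrainedLS (hM : HasPolyRIP n ℓ M δ) (hδ : 0 ≤ δ) (hν : 0 ≤ ν)
    (hδ1 : δ < 1) (he : NoiseBound n ℓ M e ν)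
    {f y : EuclideanSpace ℝ (Fin d)} (hf : f ∈ signalSpace n S) (hy : y ∈ signalSpace n T)
    {b : Coeffs n d} (hb : IsConstrainedLS M (M.toEuclideanLin f + e) T b)
    (hcard : (S ∪ T).card ≤ ℓ) :
    (1 - δ) * ‖f - synth b‖ ≤ 2 * ‖f - y‖ + ν := by
  have hbT : synth b ∈ signalSpace n T := synth_mem_signalSpace ((jumpsWithin_iff T b).1 hb.1)
  set u := synth b
  have hz : y - u ∈ signalSpace n T := sub_mem hy hbT
  have horth := hb.inner_eq_zero hz
  have hzW := signalSpace_mono (Finset.subset_union_right (s₁ := S)) hz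
  have hwW : f - y ∈ signalSpace n (S ∪ T) :=
    sub_mem (signalSpace_mono Finset.subset_union_left hf)
      (signalSpace_mono Finset.subset_union_right hy)
  have hsplit : M.toEuclideanLin f + e - M.toEuclideanLin u =
      M.toEuclideanLin (f - y) + M.toEuclideanLin (y - u) + e := by
    simp only [map_sub]
    abel
  rw [hsplit, inner_add_left, inner_add_left, real_inner_self_eq_norm_sq] at horth
  have h1 := hM.inner_sub_inner_le' hcard hwW hzW
  have h2 := he _ hcard _ (neg_mem hzW)
  rw [map_neg, inner_neg_right, norm_neg] at h2
  have h3 := (hM _ (isPiecewisePoly_iff.2 ⟨_, hcard, hzW⟩)).1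
  have h4 := neg_le_of_abs_le (abs_real_inner_le_norm (f - y) (y - u))
  have htri : ‖f - u‖ ≤ ‖f - y‖ + ‖y - u‖ := norm_sub_le_norm_sub_add_norm_sub _ _ _
  have h5 : (1 - δ) * ‖y - u‖ ≤ (1 + δ) * ‖f - y‖ + ν := by
    rcases (norm_nonneg (y - u)).eq_or_lt with h0 | h0
    · rw [← h0, mul_zero]
      positivity
    · refine le_of_mul_le_mul_right ?_ h0
      nlinarith
  nlinarith

theorem norm_synth_sub_le_of_isProjection {f v : EuclideanSpace ℝ (Fin d)} {b : Coeffs n d}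
    (hb : IsProjection v k b) (hf : IsPiecewisePoly n k f) :
    ‖synth b - f‖ ≤ 2 * ‖f - v‖ := by
  have h1 := hb.2 f hf
  have h2 : ‖synth b - f‖ ≤ ‖synth b - v‖ + ‖v - f‖ := norm_sub_le_norm_sub_add_norm_sub _ _ _
  rw [norm_sub_rev (synth b) v] at h2
  rw [norm_sub_rev f v]
  linarith

/-- The properties that every state in a run of SSCoSaMP has. -/
structure SSCoSaMPState.IsAdmissible (n k : ℕ) (M : Matrix (Fin m) (Fin d) ℝ)
    (g : EuclideanSpace ℝ (Fin m)) (s : SSCoSaMPState m d) : Prop where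
  card_le : s.jumpSet.card ≤ k
  estimate_mem : s.estimate ∈ signalSpace n s.jumpSet
  residual_eq : s.residual = g - M.toEuclideanLin s.estimate

theorem SSCoSaMPStep.isAdmissible {γ : ℕ} {g : EuclideanSpace ℝ (Fin m)} {s s' : SSCoSaMPState m d}
    (h : SSCoSaMPStep n k γ M g s s') : s'.IsAdmissible n k M g := by
  obtain ⟨_, _, b, -, -, hb, h1, h2, h3⟩ := h
  exact ⟨h2 ▸ hb.1, h1 ▸ h2 ▸ synth_mem_signalSpace subset_rfl, h3⟩

theorem IsSSCoSaMPRun.isAdmissible {γ : ℕ} {g : EuclideanSpace ℝ (Fin m)}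
    {s : ℕ → SSCoSaMPState m d} (h : IsSSCoSaMPRun n k γ M g s) (t : ℕ) :
    (s t).IsAdmissible n k M g := by
  cases t with
  | zero => rw [h.init]; exact ⟨by simp, zero_mem _, by simp⟩
  | succ t => exact (h.step t).isAdmissible

/-- Each iteration contracts the error, up to a multiple of the noise bound. -/
theorem SSCoSaMPStep.norm_estimate_sub_le (hM : HasPolyRIP n (4 * k) M δ) (hδ : 0 ≤ δ)
    (hδ' : δ < 0.046) (hν : 0 ≤ ν) (he : NoiseBound n (4 * k) M e ν)
    {f : EuclideanSpace ℝ (Fin d)} (hf : f ∈ signalSpace n S) (hS : S.card ≤ k)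
    {s s' : SSCoSaMPState m d} (hs : s.IsAdmissible n k M (M.toEuclideanLin f + e))
    (h : SSCoSaMPStep n k 2 M (M.toEuclideanLin f + e) s s') :
    ‖s'.estimate - f‖ ≤ 2 / 5 * ‖s.estimate - f‖ + 11 * ν := by
  obtain ⟨br, bp, b, hbr, hbp, hb, h1, -, -⟩ := h
  have hcard := hs.card_le
  have hbrcard := hbr.1
  have hres : s.residual = M.toEuclideanLin (f - s.estimate) + e := by
    rw [hs.residual_eq, map_sub]
    abel
  rw [hres] at hbr
  have hU := Finset.card_union_le S s.jumpSet
  have hU' := Finset.card_union_le (S ∪ s.jumpSet) (jumps br)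
  have hw : ‖f - s.estimate - synth br‖ ≤ 2 * (δ * ‖f - s.estimate‖ + ν) :=
    norm_sub_synth_le_of_isProjection hM hδ hν he
      (sub_mem (signalSpace_mono Finset.subset_union_left hf)
        (signalSpace_mono Finset.subset_union_right hs.estimate_mem))
      (by omega) hbr (by omega)
  have hp : (1 - δ) * ‖f - synth bp‖ ≤ 2 * ‖f - (s.estimate + synth br)‖ + ν :=
    norm_sub_synth_le_of_isConstrainedLS hM hδ hν (by linarith) he hf
      (add_mem (signalSpace_mono Finset.subset_union_left hs.estimate_mem)
        (synth_mem_signalSpace Finset.subset_union_right))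
      hbp (by rw [← Finset.union_assoc]; omega)
  have hb' := norm_synth_sub_le_of_isProjection hb (isPiecewisePoly_iff.2 ⟨S, hS, hf⟩)
  rw [sub_sub] at hw
  rw [h1, norm_sub_rev s.estimate f]
  have hx := norm_nonneg (f - s.estimate)
  norm_num at hδ'
  nlinarith [norm_nonneg (f - synth bp)]

/-- Once the current jump locations admit a parameterization of `f`, the noiseless iteration
returns `f`. -/
theorem SSCoSaMPStep.estimate_eq (hM : HasPolyRIP n (4 * k) M δ) (hδ : 0 ≤ δ)
    (hδ1 : δ < 1) {f : EuclideanSpace ℝ (Fin d)} (hf : f ∈ signalSpace n S) (hS : S.card ≤ k)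
    {s s' : SSCoSaMPState m d} (hcard : s.jumpSet.card ≤ k) (hfs : f ∈ signalSpace n s.jumpSet)
    (h : SSCoSaMPStep n k 2 M (M.toEuclideanLin f) s s') :
    s'.estimate = f := by
  obtain ⟨br, bp, b, hbr, hbp, hb, h1, -, -⟩ := h
  have hbrcard := hbr.1
  have hU := Finset.card_union_le s.jumpSet (jumps br)
  have hU' := Finset.card_union_le S (s.jumpSet ∪ jumps br)
  have hp : (1 - δ) * ‖f - synth bp‖ ≤ 2 * ‖f - f‖ + 0 :=
    norm_sub_synth_le_of_isConstrainedLS (e := 0) hM hδ le_rfl hδ1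
      (fun T _ z _ => by simp) hf
      (signalSpace_mono Finset.subset_union_left hfs) (by rwa [add_zero]) (by omega)
  have hb' := norm_synth_sub_le_of_isProjection hb (isPiecewisePoly_iff.2 ⟨S, hS, hf⟩)
  rw [sub_self, norm_zero, mul_zero, add_zero] at hp
  rw [h1, ← sub_eq_zero, ← norm_le_zero_iff]
  nlinarith

/-! ### Convergence of SSCoSaMP -/

theorem IsSSCoSaMPRun.norm_estimate_sub_le (hM : HasPolyRIP n (4 * k) M δ) (hδ : 0 ≤ δ)
    (hδ' : δ < 0.046) (hν : 0 ≤ ν) (he : NoiseBound n (4 * k) M e ν)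
    {f : EuclideanSpace ℝ (Fin d)} (hf : IsPiecewisePoly n k f) {s : ℕ → SSCoSaMPState m d}
    (h : IsSSCoSaMPRun n k 2 M (M.toEuclideanLin f + e) s) (t : ℕ) :
    ‖(s t).estimate - f‖ ≤ (2 / 5) ^ t * ‖f‖ + 19 * ν := by
  obtain ⟨S, hS, hfS⟩ := isPiecewisePoly_iff.1 hf
  induction t with
  | zero => simpa [h.init] using hν
  | succ t ih =>
    have := (h.step t).norm_estimate_sub_le hM hδ hδ' hν he hfS hS (h.isAdmissible t)
    rw [pow_succ]
    linarith

/-- There are only finitely many sets of jump locations, so that a signal cannot be approximated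
arbitrarily well with jump locations that do not admit it. -/
theorem exists_pos_mem_signalSpace_of_norm_sub_lt (n : ℕ) (f : EuclideanSpace ℝ (Fin d)) :
    ∃ c > 0, ∀ T, ∀ z ∈ signalSpace n T, ‖z - f‖ < c → f ∈ signalSpace n T := by
  have key : ∀ T : Finset (Fin (d - 1)), ∃ c > 0, ∀ z ∈ signalSpace n T, ‖z - f‖ < c →
      f ∈ signalSpace n T := by
    intro T
    by_cases hf : f ∈ signalSpace n T
    · exact ⟨1, one_pos, fun _ _ _ => hf⟩
    · have hclosed : IsClosed (signalSpace n T : Set (EuclideanSpace ℝ (Fin d))) :=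
        Submodule.closed_of_finiteDimensional _
      obtain ⟨c, hc, hball⟩ := Metric.isOpen_iff.1 hclosed.isOpen_compl f hf
      exact ⟨c, hc, fun z hz hzf => absurd hz (hball (mem_ball_iff_norm.2 hzf))⟩
  choose c hc hcT using key
  obtain ⟨T₀, -, hT₀⟩ := Finset.exists_min_image Finset.univ c ⟨∅, Finset.mem_univ _⟩
  exact ⟨c T₀, hc T₀, fun T z hz hzf => hcT T z hz (hzf.trans_le (hT₀ T (Finset.mem_univ T)))⟩

/-- Without noise, SSCoSaMP recovers the signal exactly after finitely many iterations. -/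
theorem exists_forall_estimate_eq (hM : HasPolyRIP n (4 * k) M δ) (hδ : 0 ≤ δ)
    (hδ' : δ < 0.046) {f : EuclideanSpace ℝ (Fin d)} (hf : IsPiecewisePoly n k f) :
    ∃ t₀ : ℕ, ∀ s : ℕ → SSCoSaMPState m d, IsSSCoSaMPRun n k 2 M (M.toEuclideanLin f) s →
      ∀ t ≥ t₀, (s t).estimate = f := by
  obtain ⟨S, hS, hfS⟩ := isPiecewisePoly_iff.1 hf
  obtain ⟨c, hc, hcT⟩ := exists_pos_mem_signalSpace_of_norm_sub_lt n f
  have hlim : Filter.Tendsto (fun t : ℕ => (2 / 5 : ℝ) ^ t * ‖f‖) Filter.atTop (nhds 0) := by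
    simpa using (tendsto_pow_atTop_nhds_zero_of_lt_one (by norm_num : (0 : ℝ) ≤ 2 / 5)
      (by norm_num)).mul_const ‖f‖
  obtain ⟨t₀, ht₀⟩ := Filter.eventually_atTop.1 (hlim.eventually (gt_mem_nhds hc))
  refine ⟨t₀ + 1, fun s hs t ht => ?_⟩
  obtain ⟨t, rfl⟩ : ∃ t', t = t' + 1 := ⟨t - 1, by omega⟩
  have hadm := hs.isAdmissible t
  have hle := IsSSCoSaMPRun.norm_estimate_sub_le (e := 0) hM hδ hδ' le_rfl
    (fun T _ z _ => by simp) hf (by rwa [add_zero]) t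
  refine (hs.step t).estimate_eq hM hδ (hδ'.trans (by norm_num)) hfS hS hadm.card_le
    (hcT _ _ hadm.estimate_mem ?_)
  have := ht₀ t (by omega)
  linarith

end Deterministic

/-! ### Gaussian tail bounds -/

section Gaussian

open ENNReal

/-- The moment-generating function of a linear combination of independent centered Gaussian
variables. -/
theorem lintegral_exp_sum_mul_of_iIndepFun {Ω ι : Type*} [Fintype ι] [MeasurableSpace Ω]
    {P : Measure Ω} {X : ι → Ω → ℝ} {v : NNReal} (hX : iIndepFun X P)
    (hlaw : ∀ i, HasLaw (X i) (gaussianReal 0 v) P) (a : ι → ℝ) :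
    ∫⁻ ω, ENNReal.ofReal (Real.exp (∑ i, a i * X i ω)) ∂P =
      ENNReal.ofReal (Real.exp (v / 2 * ∑ i, a i ^ 2)) := by
  have hind : iIndepFun (fun i ω => a i * X i ω) P :=
    hX.comp (fun i x => a i * x) fun i => measurable_const_mul (a i)
  have hmgf : mgf (∑ i, fun ω => a i * X i ω) P 1 = Real.exp (v / 2 * ∑ i, a i ^ 2) := by
    rw [hind.mgf_sum₀ (fun i => (hlaw i).aemeasurable.const_mul _), Finset.mul_sum, Real.exp_sum]
    refine Finset.prod_congr rfl fun i _ => ?_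
    rw [mgf_const_mul, mgf_gaussianReal (hlaw i).map_eq]
    congr 1
    ring
  have hint : Integrable (fun ω => Real.exp (∑ i, a i * X i ω)) P := by
    by_contra hn
    have h0 : mgf (∑ i, fun ω => a i * X i ω) P 1 = 0 := mgf_undef (by simpa using hn)
    exact (Real.exp_pos _).ne' (hmgf.symm.trans h0)
  rw [← ofReal_integral_eq_lintegral_ofReal hint (ae_of_all _ fun ω => (Real.exp_pos _).le),
    ← hmgf]
  simp [mgf]

theorem lintegral_exp_sum_sq_div_four_le (D : ℕ) :
    ∫⁻ g : Fin D → ℝ, ENNReal.ofReal (Real.exp (∑ i, g i ^ 2 / 4))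
      ∂(Measure.pi fun _ => gaussianReal 0 1) ≤ ENNReal.ofReal (Real.exp D) := by
  have h1 : ∫ x, Real.exp (x ^ 2 / 4) ∂(gaussianReal 0 1) = √2 := by
    rw [integral_gaussianReal_eq_integral_smul one_ne_zero]
    have : ∀ x : ℝ, gaussianPDFReal 0 1 x • Real.exp (x ^ 2 / 4) =
        (√(2 * Real.pi))⁻¹ * Real.exp (-(1 / 4) * x ^ 2) := by
      intro x
      rw [gaussianPDFReal, smul_eq_mul, mul_assoc, ← Real.exp_add]
      simp only [NNReal.coe_one, mul_one, sub_zero]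
      congr 2
      ring
    simp_rw [this]
    rw [integral_const_mul, integral_gaussian, ← Real.sqrt_inv, ← Real.sqrt_mul (by positivity)]
    congr 1
    field_simp
    norm_num
  have hD : ∫ g : Fin D → ℝ, Real.exp (∑ i, g i ^ 2 / 4)
      ∂(Measure.pi fun _ => gaussianReal 0 1) = √2 ^ D := by
    simp_rw [Real.exp_sum]
    rw [integral_fintype_prod_eq_pow (fun x : ℝ => Real.exp (x ^ 2 / 4)), h1, Fintype.card_fin]
  have hint : Integrable (fun g : Fin D → ℝ => Real.exp (∑ i, g i ^ 2 / 4))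
      (Measure.pi fun _ => gaussianReal 0 1) := by
    by_contra hn
    rw [integral_undef hn] at hD
    exact absurd hD.symm (by positivity)
  rw [← ofReal_integral_eq_lintegral_ofReal hint (ae_of_all _ fun ω => (Real.exp_pos _).le), hD]
  refine ofReal_le_ofReal ?_
  rw [← mul_one (D : ℝ), Real.exp_nat_mul]
  have h2 : √2 ≤ 2 := Real.sqrt_le_iff.2 ⟨by norm_num, by norm_num⟩
  exact pow_le_pow_left₀ (by positivity) (by linarith [Real.add_one_le_exp 1]) D

/-- Exponential moment of `∑ᵢ ⟪vᵢ, e⟫²` for white Gaussian noise `e` and vectors `vᵢ` whose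
synthesis operator has squared norm at most `2`. An auxiliary standard Gaussian vector `g` linearizes
the squares, as `exp (x² / 2)` is the mean of `exp (g x)`. -/
theorem IsWhiteGaussianNoise.lintegral_exp_sum_inner_sq_le {Ω : Type*} [MeasurableSpace Ω] {m D : ℕ}
    {P : Measure Ω} [IsProbabilityMeasure P] {e : Ω → EuclideanSpace ℝ (Fin m)} {σ : ℝ}
    (he : IsWhiteGaussianNoise P e σ) (hσ : 0 < σ) (v : Fin D → EuclideanSpace ℝ (Fin m))
    (hv : ∀ c : Fin D → ℝ, ‖∑ i, c i • v i‖ ^ 2 ≤ 2 * ∑ i, c i ^ 2) :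
    ∫⁻ ω, ENNReal.ofReal (Real.exp (∑ i, ⟪v i, e ω⟫ ^ 2 / (8 * σ ^ 2))) ∂P ≤
      ENNReal.ofReal (Real.exp D) := by
  set G : Measure (Fin D → ℝ) := Measure.pi fun _ => gaussianReal 0 1
  have hG : iIndepFun (fun (i : Fin D) (g : Fin D → ℝ) => g i) G :=
    iIndepFun_pi (X := fun _ x => x) fun _ => aemeasurable_id
  have hGlaw : ∀ i, HasLaw (fun g : Fin D → ℝ => g i) (gaussianReal 0 1) G := fun i =>
    ⟨(measurable_pi_apply i).aemeasurable, (measurePreserving_eval _ i).map_eq⟩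
  have hmeas : ∀ j, AEMeasurable (fun ω => e ω j) P := fun j => (he.2 j).aemeasurable
  have hinner : ∀ i ω, ⟪v i, e ω⟫ = ∑ j, v i j * e ω j := fun i ω => by
    simp [PiLp.inner_apply, mul_comm]
  have hσ2 : ((Real.toNNReal (σ ^ 2) : NNReal) : ℝ) = σ ^ 2 := Real.coe_toNNReal _ (by positivity)
  calc ∫⁻ ω, ENNReal.ofReal (Real.exp (∑ i, ⟪v i, e ω⟫ ^ 2 / (8 * σ ^ 2))) ∂P
      = ∫⁻ ω, ∫⁻ g, ENNReal.ofReal (Real.exp (∑ i, ⟪v i, e ω⟫ / (2 * σ) * g i)) ∂G ∂P := by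
        refine lintegral_congr fun ω => ?_
        rw [lintegral_exp_sum_mul_of_iIndepFun hG hGlaw, Finset.mul_sum]
        congr 2
        refine Finset.sum_congr rfl fun i _ => ?_
        simp only [NNReal.coe_one]
        field_simp
        norm_num
    _ = ∫⁻ g, ∫⁻ ω, ENNReal.ofReal (Real.exp (∑ i, ⟪v i, e ω⟫ / (2 * σ) * g i)) ∂P ∂G := by
        refine lintegral_lintegral_swap ?_
        simp only [Function.uncurry_def, hinner]
        have hfst : ∀ j, AEMeasurable (fun p : Ω × (Fin D → ℝ) => e p.1 j) (P.prod G) :=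
          fun j => (hmeas j).comp_fst
        fun_prop
    _ ≤ ∫⁻ g : Fin D → ℝ, ENNReal.ofReal (Real.exp (∑ i, g i ^ 2 / 4)) ∂G := by
        refine lintegral_mono fun g => ?_
        have hlin : ∀ ω, ∑ i, ⟪v i, e ω⟫ / (2 * σ) * g i =
            ∑ j, ((2 * σ)⁻¹ * (∑ i, g i • v i) j) * e ω j := by
          intro ω
          simp only [hinner, WithLp.ofLp_sum, Finset.sum_apply, PiLp.smul_apply, smul_eq_mul,
            Finset.sum_div, Finset.sum_mul, Finset.mul_sum]
          rw [Finset.sum_comm]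
          refine Finset.sum_congr rfl fun j _ => Finset.sum_congr rfl fun i _ => ?_
          field_simp
        simp_rw [hlin]
        rw [lintegral_exp_sum_mul_of_iIndepFun he.1 he.2, hσ2]
        refine ofReal_le_ofReal (Real.exp_le_exp.2 ?_)
        have h := hv g
        rw [EuclideanSpace.real_norm_sq_eq] at h
        simp only [mul_pow, ← Finset.mul_sum, ← Finset.sum_div]
        have : σ ^ 2 / 2 * ((2 * σ)⁻¹ ^ 2 * ∑ j, (∑ i, g i • v i) j ^ 2) =
            (∑ j, (∑ i, g i • v i) j ^ 2) / 8 := by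
          field_simp
          ring
        rw [this]
        linarith
    _ ≤ _ := lintegral_exp_sum_sq_div_four_le D

/-- Chi-square tail bound, by Markov's inequality for the exponential moment. -/
theorem IsWhiteGaussianNoise.measure_sum_inner_sq_ge_le {Ω : Type*} [MeasurableSpace Ω] {m D : ℕ}
    {P : Measure Ω} [IsProbabilityMeasure P] {e : Ω → EuclideanSpace ℝ (Fin m)} {σ : ℝ}
    (he : IsWhiteGaussianNoise P e σ) (hσ : 0 < σ) (v : Fin D → EuclideanSpace ℝ (Fin m))
    (hv : ∀ c : Fin D → ℝ, ‖∑ i, c i • v i‖ ^ 2 ≤ 2 * ∑ i, c i ^ 2) (r : ℝ) :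
    P {ω | 8 * σ ^ 2 * (D + r) ≤ ∑ i, ⟪v i, e ω⟫ ^ 2} ≤ ENNReal.ofReal (Real.exp (-r)) := by
  have hmeas : ∀ j, AEMeasurable (fun ω => e ω j) P := fun j => (he.2 j).aemeasurable
  have hinner : ∀ i ω, ⟪v i, e ω⟫ = ∑ j, v i j * e ω j := fun i ω => by
    simp [PiLp.inner_apply, mul_comm]
  have hae : AEMeasurable
      (fun ω => ENNReal.ofReal (Real.exp (∑ i, ⟪v i, e ω⟫ ^ 2 / (8 * σ ^ 2)))) P := by
    simp only [hinner]
    fun_prop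
  have hsub : {ω | 8 * σ ^ 2 * (D + r) ≤ ∑ i, ⟪v i, e ω⟫ ^ 2} ⊆
      {ω | ENNReal.ofReal (Real.exp (D + r)) ≤
        ENNReal.ofReal (Real.exp (∑ i, ⟪v i, e ω⟫ ^ 2 / (8 * σ ^ 2)))} := by
    intro ω hω
    refine ofReal_le_ofReal (Real.exp_le_exp.2 ?_)
    rw [← Finset.sum_div, le_div_iff₀ (by positivity)]
    simp only [Set.mem_ofPred_eq] at hω
    linarith
  have hmarkov := (mul_meas_ge_le_lintegral₀ hae (ENNReal.ofReal (Real.exp (D + r)))).trans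
    (he.lintegral_exp_sum_inner_sq_le hσ v hv)
  have hexp : ENNReal.ofReal (Real.exp D) =
      ENNReal.ofReal (Real.exp (D + r)) * ENNReal.ofReal (Real.exp (-r)) := by
    rw [← ofReal_mul (Real.exp_pos _).le, ← Real.exp_add]
    congr 2
    ring
  rw [hexp, ENNReal.mul_le_mul_iff_right (by simpa using Real.exp_pos _) ofReal_ne_top] at hmarkov
  exact (measure_mono hsub).trans hmarkov

end Gaussian

/-! ### The noise bound holds with high probability -/

section NoiseBound

variable {Ω : Type*} [MeasurableSpace Ω] {n m d ℓ : ℕ} {P : Measure Ω} [IsProbabilityMeasure P]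
  {e : Ω → EuclideanSpace ℝ (Fin m)} {M : Matrix (Fin m) (Fin d) ℝ} {σ δ r : ℝ}

/-- The noise bound for a single set of jump locations. In an orthonormal basis `u` of the space
of signals, the correlation with the noise is governed by the vectors `M uᵢ`. -/
theorem IsWhiteGaussianNoise.measure_exists_lt_inner_le (he : IsWhiteGaussianNoise P e σ)
    (hσ : 0 < σ) (hM : HasPolyRIP n ℓ M δ) (hδ : δ ≤ 1) (hd : 0 < d) (hr : 0 ≤ r)
    {T : Finset (Fin (d - 1))} (hT : T.card ≤ ℓ) :
    P {ω | ∃ z ∈ signalSpace n T, σ * √(8 * ((n + 1) * (ℓ + 1) + r)) * ‖z‖ <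
      ⟪e ω, M.toEuclideanLin z⟫} ≤ ENNReal.ofReal (Real.exp (-r)) := by
  set D := Module.finrank ℝ (signalSpace n T)
  let u := stdOrthonormalBasis ℝ (signalSpace n T)
  have hD : (D : ℝ) ≤ (n + 1) * (ℓ + 1) := by
    have h := (finrank_signalSpace_le n hd T).trans
      (Nat.mul_le_mul_left (n + 1) (Nat.add_le_add_right hT 1))
    exact_mod_cast h
  have hv : ∀ c : Fin D → ℝ,
      ‖∑ i, c i • M.toEuclideanLin (u i : EuclideanSpace ℝ (Fin d))‖ ^ 2 ≤ 2 * ∑ i, c i ^ 2 := by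
    intro c
    have h1 : ∑ i, c i • M.toEuclideanLin (u i : EuclideanSpace ℝ (Fin d)) =
        M.toEuclideanLin ((∑ i, c i • u i : signalSpace n T) : EuclideanSpace ℝ (Fin d)) := by
      simp
    have h2 : ‖((∑ i, c i • u i : signalSpace n T) : EuclideanSpace ℝ (Fin d))‖ ^ 2 =
        ∑ i, c i ^ 2 := by
      rw [← Submodule.coe_norm, ← u.sum_sq_norm_inner_right]
      refine Finset.sum_congr rfl fun i _ => ?_
      rw [u.orthonormal.inner_right_fintype, Real.norm_eq_abs, sq_abs]
    rw [h1, ← h2]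
    refine (hM _ (isPiecewisePoly_iff.2 ⟨T, hT, Submodule.coe_mem _⟩)).2.trans ?_
    gcongr
    linarith
  refine (measure_mono ?_).trans (he.measure_sum_inner_sq_ge_le hσ _ hv r)
  rintro ω ⟨z, hz, hlt⟩
  by_contra hn
  simp only [Set.mem_ofPred_eq, not_le] at hn
  have hzu : M.toEuclideanLin z =
      ∑ i, ⟪u i, ⟨z, hz⟩⟫ • M.toEuclideanLin (u i : EuclideanSpace ℝ (Fin d)) := by
    have h := congrArg (fun x : signalSpace n T => M.toEuclideanLin x) (u.sum_repr' ⟨z, hz⟩)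
    simpa using h.symm
  have hnorm : ∑ i, ⟪u i, (⟨z, hz⟩ : signalSpace n T)⟫ ^ 2 = ‖z‖ ^ 2 := by
    have h := u.sum_sq_norm_inner_right ⟨z, hz⟩
    simpa using h
  have hcs := Real.sum_mul_le_sqrt_mul_sqrt Finset.univ
    (fun i => ⟪u i, (⟨z, hz⟩ : signalSpace n T)⟫)
    (fun i => ⟪M.toEuclideanLin (u i : EuclideanSpace ℝ (Fin d)), e ω⟫)
  rw [hnorm, Real.sqrt_sq (norm_nonneg z)] at hcs
  have hinner : ⟪e ω, M.toEuclideanLin z⟫ = ∑ i, ⟪u i, (⟨z, hz⟩ : signalSpace n T)⟫ *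
      ⟪M.toEuclideanLin (u i : EuclideanSpace ℝ (Fin d)), e ω⟫ := by
    rw [hzu, inner_sum]
    refine Finset.sum_congr rfl fun i _ => ?_
    rw [real_inner_smul_right, real_inner_comm (e ω)]
  have hsqrt : √(∑ i, ⟪M.toEuclideanLin (u i : EuclideanSpace ℝ (Fin d)), e ω⟫ ^ 2) ≤
      σ * √(8 * ((n + 1) * (ℓ + 1) + r)) := by
    refine Real.sqrt_le_iff.2 ⟨by positivity, ?_⟩
    rw [mul_pow, Real.sq_sqrt (by positivity)]
    have : 8 * σ ^ 2 * (D + r) ≤ 8 * σ ^ 2 * ((n + 1) * (ℓ + 1) + r) := by gcongr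
    linarith
  have := mul_le_mul_of_nonneg_left hsqrt (norm_nonneg z)
  linarith

/-- A union bound over the sets of jump locations of maximal size. -/
theorem IsWhiteGaussianNoise.measure_not_noiseBound_le (he : IsWhiteGaussianNoise P e σ)
    (hσ : 0 < σ) (hM : HasPolyRIP n ℓ M δ) (hδ : δ ≤ 1) (hd : 0 < d) (hr : 0 ≤ r) :
    P {ω | ¬ NoiseBound n ℓ M (e ω) (σ * √(8 * ((n + 1) * (ℓ + 1) + r)))} ≤
      ENNReal.ofReal ((d : ℝ) ^ ℓ * Real.exp (-r)) := by
  set ν := σ * √(8 * ((n + 1) * (ℓ + 1) + r))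
  set N := Finset.powersetCard (min ℓ (d - 1)) (Finset.univ : Finset (Fin (d - 1)))
  have hsub : {ω | ¬ NoiseBound n ℓ M (e ω) ν} ⊆
      ⋃ T ∈ N, {ω | ∃ z ∈ signalSpace n T, ν * ‖z‖ < ⟪e ω, M.toEuclideanLin z⟫} := by
    intro ω hω
    simp only [NoiseBound, Set.mem_ofPred_eq, not_forall, not_le] at hω
    obtain ⟨T, hT, z, hz, hlt⟩ := hω
    obtain ⟨T', hTT', -, hT'⟩ := Finset.exists_subsuperset_card_eq (Finset.subset_univ T)
      (n := min ℓ (d - 1)) (le_min hT (T.card_le_univ.trans (by simp))) (by simp)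
    exact Set.mem_biUnion (Finset.mem_powersetCard.2 ⟨Finset.subset_univ T', hT'⟩)
      ⟨z, signalSpace_mono hTT' hz, hlt⟩
  have hN : (N.card : ℝ) ≤ (d : ℝ) ^ ℓ := by
    rw [Finset.card_powersetCard, Finset.card_univ, Fintype.card_fin]
    have h : (d - 1).choose (min ℓ (d - 1)) ≤ d ^ ℓ :=
      (Nat.choose_le_pow _ _).trans ((Nat.pow_le_pow_left (Nat.sub_le d 1) _).trans
        (Nat.pow_le_pow_right hd (min_le_left _ _)))
    exact_mod_cast h
  calc P {ω | ¬ NoiseBound n ℓ M (e ω) ν}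
      ≤ ∑ T ∈ N, P {ω | ∃ z ∈ signalSpace n T, ν * ‖z‖ < ⟪e ω, M.toEuclideanLin z⟫} :=
        (measure_mono hsub).trans (measure_biUnion_finset_le _ _)
    _ ≤ ∑ _T ∈ N, ENNReal.ofReal (Real.exp (-r)) := by
        refine Finset.sum_le_sum fun T hT => he.measure_exists_lt_inner_le hσ hM hδ hd hr ?_
        rw [(Finset.mem_powersetCard.1 hT).2]
        exact min_le_left _ _
    _ = ENNReal.ofReal (N.card * Real.exp (-r)) := by
        rw [Finset.sum_const, nsmul_eq_mul, ENNReal.ofReal_mul (Nat.cast_nonneg _),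
          ENNReal.ofReal_natCast]
    _ ≤ _ := by gcongr

end NoiseBound

theorem IsWhiteGaussianNoise.ae_eq_zero {Ω : Type*} [MeasurableSpace Ω] {m : ℕ}
    {P : Measure Ω} {e : Ω → EuclideanSpace ℝ (Fin m)}
    (he : IsWhiteGaussianNoise P e 0) : ∀ᵐ ω ∂P, e ω = 0 := by
  have h : ∀ i, ∀ᵐ ω ∂P, e ω i = 0 := by
    intro i
    have hlaw := he.2 i
    rw [zero_pow two_ne_zero, Real.toNNReal_zero, gaussianReal_zero_var] at hlaw
    refine ae_of_ae_map hlaw.aemeasurable (p := fun x => x = 0) ?_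
    rw [hlaw.map_eq, ae_dirac_eq]
    simp
  filter_upwards [ae_all_iff.2 h] with ω hω
  ext i
  exact hω i

/-- A set whose complement has small outer measure contains a measurable set of large measure. -/
theorem exists_measurableSet_subset_lt_measureReal {Ω : Type*} [MeasurableSpace Ω] {P : Measure Ω}
    [IsProbabilityMeasure P] {A : Set Ω} {p : ℝ} (hA : P Aᶜ < ENNReal.ofReal p) :
    ∃ E, MeasurableSet E ∧ 1 - p < P.real E ∧ E ⊆ A := by
  refine ⟨(toMeasurable P Aᶜ)ᶜ, (measurableSet_toMeasurable _ _).compl, ?_,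
    Set.compl_subset_comm.1 (subset_toMeasurable _ _)⟩
  rw [probReal_compl_eq_one_sub (measurableSet_toMeasurable _ _), measureReal_def,
    measure_toMeasurable]
  have := (ENNReal.lt_ofReal_iff_toReal_lt (measure_ne_top P _)).1 hA
  linarith

/-! ### The constants -/

/-- The failure probability of the union bound over `4 k` jumps with deviation
`13 k (1 + β) log (n d)`. The factor `13` leaves room for the number `d ^ (4 k)` of sets and for the
bound `(3 k)! ≤ (3 d) ^ (3 k) ≤ d ^ (9 k)`. -/
theorem pow_mul_exp_neg_le {n k d : ℕ} {β : ℝ} (hn : 1 ≤ n) (hk : 1 ≤ k) (hkd : k < d)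
    (hβ : 0 ≤ β) :
    (d : ℝ) ^ (4 * k) * Real.exp (-(13 * k * (1 + β) * Real.log (n * d))) ≤
      1 / ((3 * k).factorial : ℝ) * ((n : ℝ) * d) ^ (-β) := by
  have hfac : (3 * k).factorial * d ^ (4 * k) ≤ (n * d) ^ (13 * k) := by
    have h1 : (3 * k).factorial ≤ d ^ (9 * k) :=
      calc (3 * k).factorial ≤ (3 * k) ^ (3 * k) := Nat.factorial_le_pow _
        _ ≤ (d ^ 3) ^ (3 * k) := by
            refine Nat.pow_le_pow_left ?_ _
            nlinarith [Nat.mul_le_mul (show 2 ≤ d by omega) (show 2 ≤ d by omega)]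
        _ = d ^ (9 * k) := by rw [← pow_mul]; congr 1; ring
    calc (3 * k).factorial * d ^ (4 * k) ≤ d ^ (9 * k) * d ^ (4 * k) := Nat.mul_le_mul_right _ h1
      _ = d ^ (13 * k) := by rw [← pow_add]; congr 1; ring
      _ ≤ (n * d) ^ (13 * k) := Nat.pow_le_pow_left (Nat.le_mul_of_pos_left d hn) _
  have hfac' : ((3 * k).factorial : ℝ) * (d : ℝ) ^ (4 * k) ≤ ((n : ℝ) * d) ^ (13 * k) := by
    exact_mod_cast hfac
  have hnd : (1 : ℝ) ≤ (n : ℝ) * d := by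
    exact_mod_cast Nat.mul_pos hn (show 0 < d by omega)
  have hpos : (0 : ℝ) < (n : ℝ) * d := by linarith
  have hk' : (1 : ℝ) ≤ k := by exact_mod_cast hk
  have hL : 0 ≤ Real.log (n * d) := Real.log_nonneg hnd
  have hexp : Real.exp (-(13 * k * (1 + β) * Real.log (n * d))) ≤
      (((n : ℝ) * d) ^ (13 * k))⁻¹ * ((n : ℝ) * d) ^ (-β) := by
    rw [← Real.rpow_natCast, ← Real.rpow_neg hpos.le, ← Real.rpow_add hpos,
      Real.rpow_def_of_pos hpos]
    refine Real.exp_le_exp.2 ?_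
    push_cast
    have : 0 ≤ Real.log (n * d) * (β * (13 * k - 1)) :=
      mul_nonneg hL (mul_nonneg hβ (by linarith))
    linarith
  calc (d : ℝ) ^ (4 * k) * Real.exp (-(13 * k * (1 + β) * Real.log (n * d)))
      ≤ (d : ℝ) ^ (4 * k) * ((((n : ℝ) * d) ^ (13 * k))⁻¹ * ((n : ℝ) * d) ^ (-β)) := by gcongr
    _ = ((d : ℝ) ^ (4 * k) * (((n : ℝ) * d) ^ (13 * k))⁻¹) * ((n : ℝ) * d) ^ (-β) := by ring
    _ ≤ _ := by
        gcongr
        rw [← div_eq_mul_inv, div_le_div_iff₀ (by positivity) (by positivity)]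
        linarith

theorem sqrt_noise_le {n k β L : ℝ} (hn : 0 ≤ n) (hk : 1 ≤ k) (hβ : 0 ≤ β) (hL : 0 ≤ L) :
    √(8 * ((n + 1) * (4 * k + 1) + 13 * k * (1 + β) * L)) ≤
      5 * (√(n + 1) * √(3 * k) * (1 + √(2 * (1 + β) * L))) := by
  refine Real.sqrt_le_iff.2 ⟨by positivity, ?_⟩
  have hs : 1 + 2 * (1 + β) * L ≤ (1 + √(2 * (1 + β) * L)) ^ 2 := by
    have h := Real.sq_sqrt (show 0 ≤ 2 * (1 + β) * L by positivity)
    nlinarith [Real.sqrt_nonneg (2 * (1 + β) * L)]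
  rw [mul_pow, mul_pow, mul_pow, Real.sq_sqrt (by positivity), Real.sq_sqrt (by positivity)]
  have h1 := mul_le_mul_of_nonneg_left hs (show 0 ≤ (n + 1) * (3 * k) by positivity)
  have h2 : 0 ≤ k * ((1 + β) * L) := by positivity
  have h3 : 0 ≤ n * (k * ((1 + β) * L)) := by positivity
  nlinarith

/-! ### Near-oracle denoising -/

/-- Near-oracle denoising by SSCoSaMP (with `γ = 2`) for piecewise polynomial functions. The
constant `C n δ₄ = C₀ δ₄ * √(n + 1)` depends on the order `n` and on the isometry constant `δ₄`
only. The number `t₀` of iterations is deterministic, and the bound holds for all later iterates,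
for every run of the algorithm. -/
theorem theorem2 :
    ∃ C₀ : ℝ → ℝ, (∀ δ, 2 < C₀ δ) ∧
      ∀ (n k m d : ℕ), 1 ≤ n → 1 ≤ k → k < d →
      ∀ (M : Matrix (Fin m) (Fin d) ℝ) (δ₃ δ₄ : ℝ),
        HasPolyRIP n (3 * k) M δ₃ → HasPolyRIP n (4 * k) M δ₄ → δ₄ < 0.046 →
      ∀ f : EuclideanSpace ℝ (Fin d), IsPiecewisePoly n k f →
      ∀ σ β : ℝ, 0 ≤ σ → 0 ≤ β →
      ∀ (Ω : Type*) [MeasurableSpace Ω] (P : Measure Ω) [IsProbabilityMeasure P]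
        (e : Ω → EuclideanSpace ℝ (Fin m)), IsWhiteGaussianNoise P e σ →
      ∃ t₀ : ℕ, ∃ E : Set Ω, MeasurableSet E ∧
        1 - 2 / ((3 * k).factorial : ℝ) * ((n : ℝ) * (d : ℝ)) ^ (-β) < P.real E ∧
        ∀ ω ∈ E, ∀ s : ℕ → SSCoSaMPState m d,
          IsSSCoSaMPRun n k 2 M (M.toEuclideanLin f + e ω) s →
          ∀ t ≥ t₀, ‖(s t).estimate - f‖ ≤
            C₀ δ₄ * √((n : ℝ) + 1) * √((1 + δ₃) * (3 * (k : ℝ))) *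
              (1 + √(2 * (1 + β) * Real.log ((n : ℝ) * (d : ℝ)))) * σ := by
  -- The noise contributes `19 * 5`, the remainder of the initial error at most `1`.
  refine ⟨fun _ => 100, fun _ => by norm_num, ?_⟩
  intro n k m d hn hk hkd M δ₃ δ₄ hM₃ hM₄ hδ₄ f hf σ β hσ hβ Ω _ P _ e he
  have hd : 0 < d := by omega
  have hδ₃ : 0 ≤ δ₃ := hM₃.nonneg hd
  have hδ₄' : 0 ≤ δ₄ := hM₄.nonneg hd
  have hδ₄1 : δ₄ ≤ 1 := hδ₄.le.trans (by norm_num)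
  have hnd : (1 : ℝ) ≤ (n : ℝ) * d := by exact_mod_cast Nat.mul_pos hn hd
  have hpos : (0 : ℝ) < (n : ℝ) * d := by linarith
  have hp : 0 < 2 / ((3 * k).factorial : ℝ) * ((n : ℝ) * (d : ℝ)) ^ (-β) := by positivity
  rcases hσ.eq_or_lt with rfl | hσ
  · -- The bound is `0`, so that exact recovery is needed.
    obtain ⟨t₀, ht₀⟩ := exists_forall_estimate_eq hM₄ hδ₄' hδ₄ hf
    obtain ⟨E, hE, hPE, hsub⟩ := exists_measurableSet_subset_lt_measureReal (P := P)
      (A := {ω | e ω = 0}) (by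
        have h0 : P {ω | e ω = 0}ᶜ = 0 := he.ae_eq_zero
        rw [h0]
        exact ENNReal.ofReal_pos.2 hp)
    refine ⟨t₀, E, hE, hPE, fun ω hω s hs t ht => ?_⟩
    have hω0 : e ω = 0 := hsub hω
    rw [hω0, add_zero] at hs
    rw [ht₀ s hs t ht]
    simp
  · set L := Real.log ((n : ℝ) * (d : ℝ))
    have hL : 0 ≤ L := Real.log_nonneg hnd
    have hk' : (1 : ℝ) ≤ k := by exact_mod_cast hk
    set r := 13 * k * (1 + β) * L
    set ν := σ * √(8 * ((n + 1) * (((4 * k : ℕ) : ℝ) + 1) + r))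
    obtain ⟨E, hE, hPE, hsub⟩ := exists_measurableSet_subset_lt_measureReal (P := P)
      (A := {ω | NoiseBound n (4 * k) M (e ω) ν}) (by
        refine (he.measure_not_noiseBound_le hσ hM₄ hδ₄1 hd (by positivity)).trans_lt
          ((ENNReal.ofReal_lt_ofReal_iff hp).2 ?_)
        refine (pow_mul_exp_neg_le hn hk hkd hβ).trans_lt ?_
        gcongr
        norm_num)
    have hlim : Filter.Tendsto (fun t : ℕ => (2 / 5 : ℝ) ^ t * ‖f‖) Filter.atTop (nhds 0) := by
      simpa using (tendsto_pow_atTop_nhds_zero_of_lt_one (by norm_num : (0 : ℝ) ≤ 2 / 5)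
        (by norm_num)).mul_const ‖f‖
    obtain ⟨t₀, ht₀⟩ := Filter.eventually_atTop.1 (hlim.eventually (gt_mem_nhds hσ))
    refine ⟨t₀, E, hE, hPE, fun ω hω s hs t ht => ?_⟩
    have h1 := hs.norm_estimate_sub_le hM₄ hδ₄' hδ₄ (by positivity : 0 ≤ ν) (hsub hω) hf t
    have h2 := ht₀ t ht
    set B := √((n : ℝ) + 1) * √((1 + δ₃) * (3 * (k : ℝ))) * (1 + √(2 * (1 + β) * L))
    have hB : 1 ≤ B := by
      refine one_le_mul_of_one_le_of_one_le (one_le_mul_of_one_le_of_one_le ?_ ?_) ?_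
      · exact Real.one_le_sqrt.2 (by linarith [(Nat.cast_nonneg n : (0 : ℝ) ≤ n)])
      · exact Real.one_le_sqrt.2 (by nlinarith)
      · linarith [Real.sqrt_nonneg (2 * (1 + β) * L)]
    have hν : ν ≤ σ * (5 * B) := by
      refine mul_le_mul_of_nonneg_left ?_ hσ.le
      push_cast
      refine (sqrt_noise_le (Nat.cast_nonneg n) hk' hβ hL).trans ?_
      have h3 : √(3 * (k : ℝ)) ≤ √((1 + δ₃) * (3 * (k : ℝ))) :=
        Real.sqrt_le_sqrt (by nlinarith)
      change _ ≤ 5 * (√((n : ℝ) + 1) * √((1 + δ₃) * (3 * (k : ℝ))) * _)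
      gcongr
    calc ‖(s t).estimate - f‖ ≤ σ + 19 * (σ * (5 * B)) := by linarith
      _ ≤ 100 * (B * σ) := by nlinarith
      _ = _ := by ring
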